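/- Let $a<b$ be real numbers and let $W=\{W(t): t\in[a,b]\}$ be a real Brownian motion on $[a,b]$ (independent increments, $W(t)-W(s)\sim N(0,t-s)$ for $s\le t$, almost surely continuous paths; the value $W(a)$ is arbitrary). Let $\mathbb K$ be $\mathbb R$ or $\mathbb C$. Let $H_1$ be the space of absolutely continuous functions $h:[a,b]\to\mathbb K$ with $h(a)=h(b)=0$ and $h,h'\in L_2[a,b]$, and write $\langle f,h\rangle=\int_a^b f(t)h(t)\,dt$. The weak random operator $L$, formally $Lf=f''-Wf'-W'f$, is defined through the random bilinear form $$\langle Lf,h\rangle:=-\int_a^b f'(t)h'(t)\,dt+\int_a^b f(t)h'(t)W(t)\,dt,\qquad f,h\in H_1 .$$ Call $\lambda\in\mathbb K$ an eigenvalue of $L$ if there is an eigenfunction for $\lambda$, that is, some $e\in H_1$, $e\neq0$, such that $\langle Le,h\rangle=\langle\lambda e,h\rangle$ for all $h\in H_1$. Then, almost surely, $L$ has a discrete spectrum: the set of eigenvalues of $L$ is countably infinite, every bounded set contains only finitely many of them, and for each $\lambda$ the eigenfunctions for $\lambda$ span a finite-dimensional space. -/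

import Mathlib

open MeasureTheory ProbabilityTheory

/-- `W` (restricted to the time interval `[a, b]`) is a real Brownian motion on `[a, b]`: its
increments are independent, `W t - W s` has law `N(0, t - s)` for `s ≤ t`, and almost every path is
continuous on `[a, b]`. The value at time `a` is not prescribed, so this covers a Brownian motion
started at time `a`, the restriction to `[a, b]` of a Brownian motion on `[0, ∞)` started at time
`0`, and the restriction of a two-sided Brownian motion. -/
structure IsBrownianMotionOn {Ω : Type*} [MeasurableSpace Ω] (a b : ℝ) (W : ℝ → Ω → ℝ)
    (P : Measure Ω) : Prop where
  aemeasurable : ∀ t ∈ Set.Icc a b, AEMeasurable (W t) P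
  indepIncrements : HasIndepIncrements (fun (t : Set.Icc a b) ω => W (t : ℝ) ω) P
  law_increment : ∀ s ∈ Set.Icc a b, ∀ t ∈ Set.Icc a b, s ≤ t →
    HasLaw (fun ω => W t ω - W s ω) (gaussianReal 0 (t - s).toNNReal) P
  continuous_paths : ∀ᵐ ω ∂P, ContinuousOn (fun t => W t ω) (Set.Icc a b)

/-- The Sobolev space `H₁` of `𝕜`-valued absolutely continuous functions on `[a, b]` that vanish at
`a` and at `b` and have finite norm `∫ |h|² + ∫ |h'|²`. A function on `[a, b]` is represented by its
extension by zero to `ℝ`, so that different members of this set are different functions on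
`[a, b]`. The derivative `deriv h` exists almost everywhere on `[a, b]`, by absolute continuity. -/
def sobolevH1 (𝕜 : Type*) [RCLike 𝕜] (a b : ℝ) : Set (ℝ → 𝕜) :=
  {h | AbsolutelyContinuousOnInterval h a b ∧ h a = 0 ∧ h b = 0 ∧
    (∀ t, t ∉ Set.Icc a b → h t = 0) ∧
    MemLp h 2 (volume.restrict (Set.Icc a b)) ∧
    MemLp (deriv h) 2 (volume.restrict (Set.Icc a b))}

/-- The bilinear form `ε(f, h) = ⟨L f, h⟩ = -∫ f' h' + ∫ f h' w` (integrals over `[a, b]`) of the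
formal operator `L f = f'' - w f' - w' f` with coefficient path `w`. -/
noncomputable def weakForm {𝕜 : Type*} [RCLike 𝕜] (a b : ℝ) (w : ℝ → ℝ) (f h : ℝ → 𝕜) : 𝕜 :=
  -(∫ t in a..b, deriv f t * deriv h t) + ∫ t in a..b, f t * deriv h t * (w t : 𝕜)

/-- The pairing `⟨f, h⟩ = ∫ f h` over `[a, b]`. -/
noncomputable def pairing {𝕜 : Type*} [RCLike 𝕜] (a b : ℝ) (f h : ℝ → 𝕜) : 𝕜 :=
  ∫ t in a..b, f t * h t

/-- The eigenfunctions of the weak operator `L` for the number `μ`: the nonzero `e ∈ H₁` with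
`⟨L e, h⟩ = ⟨μ e, h⟩` for all `h ∈ H₁`. -/
def weakEigenfunctions (𝕜 : Type*) [RCLike 𝕜] (a b : ℝ) (w : ℝ → ℝ) (μ : 𝕜) : Set (ℝ → 𝕜) :=
  {e | e ∈ sobolevH1 𝕜 a b ∧ e ≠ 0 ∧
    ∀ h ∈ sobolevH1 𝕜 a b, weakForm a b w e h = pairing a b (fun t => μ * e t) h}

/-- The set of eigenvalues of the weak operator `L`. -/
def weakEigenvalues (𝕜 : Type*) [RCLike 𝕜] (a b : ℝ) (w : ℝ → ℝ) : Set 𝕜 :=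
  {μ | (weakEigenfunctions 𝕜 a b w μ).Nonempty}

/-! ### Calculus of absolutely continuous functions with values in `𝕜`. -/

section AbsoluteContinuity

open AbsolutelyContinuousOnInterval Filter Topology

/-! The argument is deterministic, for one continuous path `w`. By the lemma of du Bois-Reymond, a
weak eigenfunction `e` for `μ` is a classical solution of the system `e' = w e + q`, `q' = μ e` with
`e a = e b = 0`. The quasi-derivative `q = e' - w e` absorbs the formal term `w'`, so `w` is never
differentiated. With `σ = exp (-∫ w)` one has `(σ e)' = σ q`, so this is a regular Sturm–Liouville
problem, symmetric for the weight `σ`.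

Discreteness: eigenvalues are real, and for distinct eigenvalues both the `e` and the `q` are
orthogonal in `L²(σ)`, with `∫ σ |q|² = |μ| ∫ σ |e|²`. Since `σ(x) e(x) = ∫_a^x σ q` is an inner
product of `q` with the indicator of `[a, x]`, Bessel's inequality bounds a sum over eigenvalues at
each `x`. Integrating over `x` gives the trace bound `∑ |μ|⁻¹ ≤ ∫ σ · ∫ σ⁻¹`
(`sum_inv_norm_weakEigenvalues_le`), so bounded sets contain finitely many eigenvalues. No compact
operator is needed. Eigenspaces are at most one-dimensional, because `q a` determines a solution
with `e a = 0`.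

Infinitude: for `μ = -s²` write `σ e = r sin φ`, `q = s r cos φ`. The angle satisfies `φ' = s (σ
cos² φ + σ⁻¹ sin² φ)`, `φ a = 0`. Its endpoint `φ b` depends continuously on `s`, vanishes at `s =
0` and grows at least linearly, so it takes every value `n π` with `n ≥ 1`. Each such value yields
an eigenvalue. -/

theorem AbsolutelyContinuousOnInterval.of_dist_le {X Y : Type*} [PseudoMetricSpace X]
    [PseudoMetricSpace Y] {f : ℝ → X} {g : ℝ → Y} {a b : ℝ}
    (hg : AbsolutelyContinuousOnInterval g a b)
    (h : ∀ x ∈ Set.uIcc a b, ∀ y ∈ Set.uIcc a b, dist (f x) (f y) ≤ dist (g x) (g y)) :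
    AbsolutelyContinuousOnInterval f a b := by
  refine squeeze_zero' (.of_forall fun E => Finset.sum_nonneg fun _ _ => dist_nonneg) ?_ hg
  have : ∀ᶠ E : ℕ × (ℕ → ℝ × ℝ) in totalLengthFilter ⊓ 𝓟 (disjWithin a b), E ∈ disjWithin a b :=
    eventually_inf_principal.mpr (by simp)
  filter_upwards [this] with E hE
  exact Finset.sum_le_sum fun i hi => h _ (hE.1 i hi).1 _ (hE.1 i hi).2

theorem AbsolutelyContinuousOnInterval.congr {X : Type*} [PseudoMetricSpace X]
    {f g : ℝ → X} {a b : ℝ} (hg : AbsolutelyContinuousOnInterval g a b)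
    (h : Set.EqOn f g (Set.uIcc a b)) : AbsolutelyContinuousOnInterval f a b :=
  hg.of_dist_le fun x hx y hy => by rw [h hx, h hy]

/-- Increments of the primitive are dominated by those of the real primitive of `‖f‖`, which reduces
the claim to the real case. -/
theorem IntervalIntegrable.absolutelyContinuousOnInterval_primitive {E : Type*}
    [NormedAddCommGroup E] [NormedSpace ℝ E] {f : ℝ → E} {a b : ℝ}
    (hf : IntervalIntegrable f volume a b) :
    AbsolutelyContinuousOnInterval (fun x => ∫ t in a..x, f t) a b := by
  refine (hf.norm.absolutelyContinuousOnInterval_intervalIntegral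
    (Set.left_mem_uIcc)).of_dist_le fun x hx y hy => ?_
  have hx' : IntervalIntegrable f volume a x :=
    hf.mono_set (Set.uIcc_subset_uIcc Set.left_mem_uIcc hx)
  have hy' : IntervalIntegrable f volume a y :=
    hf.mono_set (Set.uIcc_subset_uIcc Set.left_mem_uIcc hy)
  rw [dist_eq_norm, dist_eq_norm, intervalIntegral.integral_interval_sub_left hx' hy',
    intervalIntegral.integral_interval_sub_left hx'.norm hy'.norm, Real.norm_eq_abs]
  exact intervalIntegral.norm_integral_le_abs_integral_norm

variable {𝕜 : Type*} [RCLike 𝕜] {a b : ℝ} {f g : ℝ → 𝕜}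

theorem AbsolutelyContinuousOnInterval.ae_differentiableAt_rclike
    (hf : AbsolutelyContinuousOnInterval f a b) :
    ∀ᵐ x : ℝ, x ∈ Set.uIcc a b → DifferentiableAt ℝ f x :=
  hf.boundedVariationOn.ae_differentiableAt_of_mem_uIcc

/-- The difference of `f` and the primitive of `deriv f` is absolutely continuous with derivative
zero almost everywhere, hence constant. -/
theorem AbsolutelyContinuousOnInterval.integral_deriv_eq_sub_rclike
    (hf : AbsolutelyContinuousOnInterval f a b) (hi : IntervalIntegrable (deriv f) volume a b) :
    ∫ x in a..b, deriv f x = f b - f a := by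
  have hac := hf.sub hi.absolutelyContinuousOnInterval_primitive
  obtain ⟨C, hC⟩ := hac.const_of_ae_hasDerivAt_zero (by
    filter_upwards [hf.ae_differentiableAt_rclike, hi.ae_hasDerivAt_integral] with x h1 h2 hx
    simpa using (h1 hx).hasDerivAt.sub (h2 hx a Set.left_mem_uIcc))
  have h1 := hC a Set.left_mem_uIcc
  have h2 := hC b Set.right_mem_uIcc
  simp only [Pi.sub_apply, intervalIntegral.integral_same, sub_zero] at h1 h2
  rw [h1, ← h2]
  ring

theorem AbsolutelyContinuousOnInterval.integral_deriv_mul_eq_sub_rclike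
    (hf : AbsolutelyContinuousOnInterval f a b) (hg : AbsolutelyContinuousOnInterval g a b)
    (hfi : IntervalIntegrable (deriv f) volume a b)
    (hgi : IntervalIntegrable (deriv g) volume a b) :
    ∫ x in a..b, (deriv f x * g x + f x * deriv g x) = f b * g b - f a * g a := by
  have hae : ∀ᵐ x, x ∈ Set.uIoc a b →
      deriv f x * g x + f x * deriv g x = deriv (fun y => f y * g y) x := by
    filter_upwards [hf.ae_differentiableAt_rclike, hg.ae_differentiableAt_rclike] with x h1 h2 hx
    have hx' := Set.uIoc_subset_uIcc hx
    exact ((h1 hx').hasDerivAt.mul (h2 hx').hasDerivAt).deriv.symm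
  have hint : IntervalIntegrable (fun x => deriv f x * g x + f x * deriv g x) volume a b :=
    (hfi.mul_continuousOn hg.continuousOn).add (hgi.continuousOn_mul hf.continuousOn)
  have hac : AbsolutelyContinuousOnInterval (fun y => f y * g y) a b := hf.fun_smul hg
  rw [intervalIntegral.integral_congr_ae hae, hac.integral_deriv_eq_sub_rclike]
  exact hint.congr_ae ((ae_restrict_iff' measurableSet_uIoc).2 hae)

end AbsoluteContinuity

/-! ### Primitives on a closed interval and the lemma of du Bois-Reymond. -/

section Regularity

open Set Filter Topology

theorem ContinuousOn.hasDerivWithinAt_primitive {E : Type*} [NormedAddCommGroup E]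
    [NormedSpace ℝ E] [CompleteSpace E] {f : ℝ → E} {a b x : ℝ} (hf : ContinuousOn f (Icc a b))
    (hx : x ∈ Icc a b) :
    HasDerivWithinAt (fun y => ∫ t in a..y, f t) (f x) (Icc a b) x := by
  have : Fact (x ∈ Icc a b) := ⟨hx⟩
  refine intervalIntegral.integral_hasDerivWithinAt_right ?_
    (hf.stronglyMeasurableAtFilter_nhdsWithin measurableSet_Icc x) (hf x hx)
  refine ContinuousOn.intervalIntegrable (hf.mono ?_)
  rw [uIcc_of_le hx.1]
  exact Icc_subset_Icc_right hx.2

theorem HasDerivWithinAt.hasDerivAt_of_mem_Ioo {E : Type*} [NormedAddCommGroup E]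
    [NormedSpace ℝ E] {f : ℝ → E} {f' : E} {a b x : ℝ}
    (hf : HasDerivWithinAt f f' (Icc a b) x) (hx : x ∈ Ioo a b) : HasDerivAt f f' x :=
  hf.hasDerivAt (Icc_mem_nhds hx.1 hx.2)

theorem integral_eq_sub_of_hasDerivWithinAt_Icc {E : Type*} [NormedAddCommGroup E]
    [NormedSpace ℝ E] [CompleteSpace E] {f f' : ℝ → E} {a b : ℝ} (hab : a ≤ b)
    (hf : ∀ x ∈ Icc a b, HasDerivWithinAt f (f' x) (Icc a b) x)
    (hf' : ContinuousOn f' (Icc a b)) : ∫ x in a..b, f' x = f b - f a :=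
  intervalIntegral.integral_eq_sub_of_hasDerivAt_of_le hab (fun x hx => (hf x hx).continuousWithinAt)
    (fun x hx => (hf x (Ioo_subset_Icc_self hx)).hasDerivAt_of_mem_Ioo hx)
    (ContinuousOn.intervalIntegrable (by rwa [uIcc_of_le hab]))

theorem eq_primitive_of_hasDerivWithinAt_Icc {E : Type*} [NormedAddCommGroup E]
    [NormedSpace ℝ E] [CompleteSpace E] {f f' : ℝ → E} {a b t : ℝ}
    (hf : ∀ x ∈ Icc a b, HasDerivWithinAt f (f' x) (Icc a b) x)
    (hf' : ContinuousOn f' (Icc a b)) (ht : t ∈ Icc a b) : ∫ x in a..t, f' x = f t - f a := by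
  have hs : Icc a t ⊆ Icc a b := Icc_subset_Icc_right ht.2
  exact integral_eq_sub_of_hasDerivWithinAt_Icc ht.1 (fun x hx => (hf x (hs hx)).mono hs)
    (hf'.mono hs)

theorem absolutelyContinuousOnInterval_of_hasDerivWithinAt_Icc {E : Type*} [NormedAddCommGroup E]
    [NormedSpace ℝ E] [CompleteSpace E] {f f' : ℝ → E} {a b : ℝ} (hab : a ≤ b)
    (hf : ∀ x ∈ Icc a b, HasDerivWithinAt f (f' x) (Icc a b) x)
    (hf' : ContinuousOn f' (Icc a b)) : AbsolutelyContinuousOnInterval f a b := by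
  have hi : IntervalIntegrable f' volume a b :=
    ContinuousOn.intervalIntegrable (by rwa [uIcc_of_le hab])
  refine hi.absolutelyContinuousOnInterval_primitive.of_dist_le fun x hx y hy => ?_
  rw [uIcc_of_le hab] at hx hy
  rw [eq_primitive_of_hasDerivWithinAt_Icc hf hf' hx, eq_primitive_of_hasDerivWithinAt_Icc hf hf' hy,
    dist_sub_right]

theorem ContinuousOn.memLp_two_Icc {E : Type*} [NormedAddCommGroup E] {f : ℝ → E} {a b : ℝ}
    (hf : ContinuousOn f (Icc a b)) : MemLp f 2 (volume.restrict (Icc a b)) := by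
  obtain ⟨C, hC⟩ := isCompact_Icc.exists_bound_of_continuousOn hf
  exact MemLp.of_bound (hf.aestronglyMeasurable_of_isCompact isCompact_Icc measurableSet_Icc) C
    ((ae_restrict_iff' measurableSet_Icc).2 (.of_forall hC))

theorem MeasureTheory.MemLp.intervalIntegrable_of_Icc {E : Type*} [NormedAddCommGroup E]
    {f : ℝ → E} {a b : ℝ} (hab : a ≤ b) (hf : MemLp f 2 (volume.restrict (Icc a b))) :
    IntervalIntegrable f volume a b :=
  (intervalIntegrable_iff_integrableOn_Icc_of_le hab).2 (hf.integrable one_le_two)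

variable {𝕜 : Type*} [RCLike 𝕜] {a b : ℝ}

theorem intervalIntegral_ofReal_rclike (g : ℝ → ℝ) :
    ∫ t in a..b, (g t : 𝕜) = ((∫ t in a..b, g t : ℝ) : 𝕜) := by
  simp only [intervalIntegral, integral_ofReal, RCLike.ofReal_sub]

/-- The **lemma of du Bois-Reymond**: an integrable function that is orthogonal to all continuous
functions of mean zero is constant almost everywhere. -/
theorem exists_ae_eq_const_of_integral_mul_eq_zero {m : ℝ → 𝕜} (hab : a < b)
    (hm : IntervalIntegrable m volume a b)
    (h : ∀ g : ℝ → ℝ, Continuous g → ∫ t in a..b, g t = 0 → ∫ t in a..b, m t * (g t : 𝕜) = 0) :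
    ∃ c : 𝕜, ∀ᵐ x, x ∈ Ioo a b → m x = c := by
  have hba : (b - a : ℝ) ≠ 0 := (sub_pos.2 hab).ne'
  set c : 𝕜 := (∫ t in a..b, m t) / ((b - a : ℝ) : 𝕜) with hc
  refine ⟨c, ?_⟩
  have hmc : IntervalIntegrable (fun t => m t - c) volume a b :=
    hm.sub intervalIntegrable_const
  have hIoo : IntegrableOn (fun t => m t - c) (Ioo a b) volume :=
    ((intervalIntegrable_iff_integrableOn_Ioo_of_le hab.le).1 hmc)
  have key := isOpen_Ioo.ae_eq_zero_of_integral_contDiff_smul_eq_zero (U := Ioo a b)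
    (f := fun t => m t - c) hIoo.locallyIntegrableOn (fun g hg _ hsupp => by
      have hgc : Continuous g := hg.continuous
      have hgk : Continuous fun t => (g t : 𝕜) := RCLike.continuous_ofReal.comp hgc
      have hgI : IntervalIntegrable (fun t => (g t : 𝕜)) volume a b := hgk.intervalIntegrable _ _
      -- A compactly supported test function need not have mean zero; subtracting its mean `d` makes
      -- the hypothesis applicable. As `c` is the mean of `m`, the correction contributes exactly `c
      -- * ∫ g`.
      set d : ℝ := (∫ t in a..b, g t) / (b - a) with hd
      have h0 := h (fun t => g t - d) (hgc.sub continuous_const) (by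
        rw [intervalIntegral.integral_sub (hgc.intervalIntegrable _ _) intervalIntegrable_const,
          intervalIntegral.integral_const, smul_eq_mul, hd]
        field_simp
        ring)
      have hmg : IntervalIntegrable (fun t => m t * (g t : 𝕜)) volume a b :=
        hm.mul_continuousOn hgk.continuousOn
      have e1 : ∫ t in a..b, m t * ((g t - d : ℝ) : 𝕜)
          = (∫ t in a..b, m t * (g t : 𝕜)) - (∫ t in a..b, m t) * (d : 𝕜) := by
        rw [← intervalIntegral.integral_mul_const,
          ← intervalIntegral.integral_sub hmg (hm.mul_const _)]
        congr 1; ext t; push_cast; ring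
      have hdc : (∫ t in a..b, m t) * (d : 𝕜) = c * ∫ t in a..b, (g t : 𝕜) := by
        rw [intervalIntegral_ofReal_rclike, hd, hc]
        push_cast
        ring
      have hset : ∫ x, g x • (m x - c) = ∫ x in Ioc a b, g x • (m x - c) := by
        refine (setIntegral_eq_integral_of_forall_compl_eq_zero fun x hx => ?_).symm
        rw [image_eq_zero_of_notMem_tsupport fun hx' => hx (Ioo_subset_Ioc_self (hsupp hx')),
          zero_smul]
      rw [hset, ← intervalIntegral.integral_of_le hab.le]
      calc ∫ t in a..b, g t • (m t - c)
          = ∫ t in a..b, (m t * (g t : 𝕜) - c * (g t : 𝕜)) := by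
            congr 1; ext t; rw [RCLike.real_smul_eq_coe_mul]; ring
        _ = (∫ t in a..b, m t * (g t : 𝕜)) - c * ∫ t in a..b, (g t : 𝕜) := by
            rw [intervalIntegral.integral_sub hmg (hgI.const_mul _),
              intervalIntegral.integral_const_mul]
        _ = 0 := by rw [← hdc, ← e1, h0])
  filter_upwards [key] with x hx hx'
  exact sub_eq_zero.1 (hx hx')

end Regularity

/-! ### Weak eigenfunctions and classical Dirichlet solutions. -/

section Weak

open Set Filter Topology

variable {𝕜 : Type*} [RCLike 𝕜] {a b : ℝ} {w : ℝ → ℝ} {μ : 𝕜} {e q : ℝ → 𝕜}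

theorem weakForm_congr {w w' : ℝ → ℝ} (hab : a ≤ b) (h : EqOn w w' (Icc a b)) (f g : ℝ → 𝕜) :
    weakForm a b w f g = weakForm a b w' f g := by
  unfold weakForm
  congr 1
  refine intervalIntegral.integral_congr fun t ht => ?_
  rw [uIcc_of_le hab] at ht
  simp only [h ht]

theorem weakEigenfunctions_congr {w w' : ℝ → ℝ} (hab : a ≤ b) (h : EqOn w w' (Icc a b)) (μ : 𝕜) :
    weakEigenfunctions 𝕜 a b w μ = weakEigenfunctions 𝕜 a b w' μ := by
  simp only [weakEigenfunctions, weakForm_congr hab h]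

theorem weakEigenvalues_congr {w w' : ℝ → ℝ} (hab : a ≤ b) (h : EqOn w w' (Icc a b)) :
    weakEigenvalues 𝕜 a b w = weakEigenvalues 𝕜 a b w' := by
  simp only [weakEigenvalues, weakEigenfunctions_congr hab h]

/-- A classical solution of the Dirichlet problem `(e' - w e)' = μ e`, `e a = e b = 0`, written as a
first order system with the quasi-derivative `q = e' - w e`. -/
structure IsDirichletSolution (a b : ℝ) (w : ℝ → ℝ) (μ : 𝕜) (e q : ℝ → 𝕜) : Prop where
  left : e a = 0
  right : e b = 0
  deriv_fst : ∀ t ∈ Icc a b, HasDerivWithinAt e ((w t : 𝕜) * e t + q t) (Icc a b) t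
  deriv_snd : ∀ t ∈ Icc a b, HasDerivWithinAt q (μ * e t) (Icc a b) t

theorem IsDirichletSolution.continuousOn_fst (h : IsDirichletSolution a b w μ e q) :
    ContinuousOn e (Icc a b) := fun t ht => (h.deriv_fst t ht).continuousWithinAt

theorem IsDirichletSolution.continuousOn_snd (h : IsDirichletSolution a b w μ e q) :
    ContinuousOn q (Icc a b) := fun t ht => (h.deriv_snd t ht).continuousWithinAt

theorem ae_restrict_Icc_of_forall_Ioo {p : ℝ → Prop} (h : ∀ x ∈ Ioo a b, p x) :
    ∀ᵐ x ∂volume.restrict (Icc a b), p x := by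
  rw [← restrict_Ioo_eq_restrict_Icc]
  exact (ae_restrict_iff' measurableSet_Ioo).2 (.of_forall h)

theorem ae_uIoc_of_forall_Ioo {p : ℝ → Prop} (hab : a ≤ b) (h : ∀ x ∈ Ioo a b, p x) :
    ∀ᵐ x, x ∈ uIoc a b → p x := by
  rw [uIoc_of_le hab, ← ae_restrict_iff' measurableSet_Ioc, ← restrict_Ioo_eq_restrict_Ioc]
  exact (ae_restrict_iff' measurableSet_Ioo).2 (.of_forall h)

theorem mem_sobolevH1_of_hasDerivWithinAt {f f' : ℝ → 𝕜} (hab : a ≤ b)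
    (hf : ∀ x ∈ Icc a b, HasDerivWithinAt f (f' x) (Icc a b) x) (hf' : ContinuousOn f' (Icc a b))
    (ha : f a = 0) (hb : f b = 0) (h0 : ∀ t, t ∉ Icc a b → f t = 0) : f ∈ sobolevH1 𝕜 a b := by
  refine ⟨absolutelyContinuousOnInterval_of_hasDerivWithinAt_Icc hab hf hf', ha, hb, h0,
    ContinuousOn.memLp_two_Icc fun x hx => (hf x hx).continuousWithinAt, ?_⟩
  -- The extension by zero may fail to be differentiable at `a` and `b`, so `deriv f` is identified
  -- only in the open interval.
  refine hf'.memLp_two_Icc.ae_eq (ae_restrict_Icc_of_forall_Ioo fun x hx => ?_)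
  exact ((hf x (Ioo_subset_Icc_self hx)).hasDerivAt_of_mem_Ioo hx).deriv.symm

/-- Substituting `e' = w e + q` turns the form into `-∫ q g'`; integration by parts against `g`,
which vanishes at both ends, gives `∫ μ e g`. -/
theorem IsDirichletSolution.mem_weakEigenfunctions (hab : a ≤ b) (hw : Continuous w)
    (h : IsDirichletSolution a b w μ e q) (h0 : ∀ t, t ∉ Icc a b → e t = 0) (hne : e ≠ 0) :
    e ∈ weakEigenfunctions 𝕜 a b w μ := by
  have hwk : Continuous fun t => (w t : 𝕜) := RCLike.continuous_ofReal.comp hw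
  have hec := h.continuousOn_fst
  have hqc := h.continuousOn_snd
  have he'c : ContinuousOn (fun t => (w t : 𝕜) * e t + q t) (Icc a b) :=
    (hwk.continuousOn.mul hec).add hqc
  have hq'c : ContinuousOn (fun t => μ * e t) (Icc a b) := continuousOn_const.mul hec
  refine ⟨mem_sobolevH1_of_hasDerivWithinAt hab h.deriv_fst he'c h.left h.right h0, hne,
    fun g hg => ?_⟩
  obtain ⟨hgac, hga, hgb, -, -, hgd⟩ := hg
  have hgi := hgd.intervalIntegrable_of_Icc hab
  have huIcc := uIcc_of_le hab
  have hqac := absolutelyContinuousOnInterval_of_hasDerivWithinAt_Icc hab h.deriv_snd hq'c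
  have hqd : ∀ x ∈ Ioo a b, deriv q x = μ * e x := fun x hx =>
    ((h.deriv_snd x (Ioo_subset_Icc_self hx)).hasDerivAt_of_mem_Ioo hx).deriv
  have hed : ∀ x ∈ Ioo a b, deriv e x = (w x : 𝕜) * e x + q x := fun x hx =>
    ((h.deriv_fst x (Ioo_subset_Icc_self hx)).hasDerivAt_of_mem_Ioo hx).deriv
  have hqi : IntervalIntegrable (deriv q) volume a b := by
    refine (ContinuousOn.intervalIntegrable (huIcc ▸ hq'c)).congr_ae ?_
    exact (ae_restrict_iff' measurableSet_uIoc).2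
      (ae_uIoc_of_forall_Ioo hab fun x hx => (hqd x hx).symm)
  have key := hqac.integral_deriv_mul_eq_sub_rclike hgac hqi hgi
  rw [hga, hgb, mul_zero, mul_zero, sub_zero] at key
  have hi1 : IntervalIntegrable (fun t => ((w t : 𝕜) * e t + q t) * deriv g t) volume a b :=
    hgi.continuousOn_mul (huIcc ▸ he'c)
  have hi2 : IntervalIntegrable (fun t => e t * deriv g t * (w t : 𝕜)) volume a b :=
    (hgi.continuousOn_mul (huIcc ▸ hec)).mul_continuousOn hwk.continuousOn
  have hi3 : IntervalIntegrable (fun t => μ * e t * g t) volume a b :=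
    ((huIcc ▸ hq'c : ContinuousOn _ (uIcc a b)).mul hgac.continuousOn).intervalIntegrable
  have hi4 : IntervalIntegrable (fun t => q t * deriv g t) volume a b :=
    hgi.continuousOn_mul (huIcc ▸ hqc)
  have k1 : ∫ t in a..b, deriv e t * deriv g t
      = ∫ t in a..b, ((w t : 𝕜) * e t + q t) * deriv g t :=
    intervalIntegral.integral_congr_ae (ae_uIoc_of_forall_Ioo hab fun x hx => by rw [hed x hx])
  have k2 : ∫ t in a..b, (deriv q t * g t + q t * deriv g t)
      = ∫ t in a..b, (μ * e t * g t + q t * deriv g t) :=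
    intervalIntegral.integral_congr_ae (ae_uIoc_of_forall_Ioo hab fun x hx => by rw [hqd x hx])
  rw [k2, intervalIntegral.integral_add hi3 hi4] at key
  unfold weakForm pairing
  rw [k1, neg_add_eq_sub, ← intervalIntegral.integral_sub hi2 hi1, eq_neg_of_add_eq_zero_left key,
    ← intervalIntegral.integral_neg]
  congr 1
  ext t
  ring

/-- A weak eigenfunction is a classical solution. -/
theorem exists_isDirichletSolution_of_mem_weakEigenfunctions (hab : a < b) (hw : Continuous w)
    (he : e ∈ weakEigenfunctions 𝕜 a b w μ) : ∃ q, IsDirichletSolution a b w μ e q := by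
  obtain ⟨⟨heac, hea, heb, he0, -, hed⟩, -, hweak⟩ := he
  have huIcc := uIcc_of_le hab.le
  have hwk : Continuous fun t => (w t : 𝕜) := RCLike.continuous_ofReal.comp hw
  have hec : ContinuousOn e (Icc a b) := huIcc ▸ heac.continuousOn
  have hei := hed.intervalIntegrable_of_Icc hab.le
  have hμe : ContinuousOn (fun t => μ * e t) (Icc a b) := continuousOn_const.mul hec
  -- The quasi-derivative must be a primitive of `μ e`; `Q` is one, and the missing constant `c`
  -- comes from du Bois-Reymond applied to `e' - w e - Q`.
  set Q : ℝ → 𝕜 := fun x => ∫ t in a..x, μ * e t with hQ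
  have hQd : ∀ t ∈ Icc a b, HasDerivWithinAt Q (μ * e t) (Icc a b) t := fun t ht =>
    hμe.hasDerivWithinAt_primitive ht
  have hQc : ContinuousOn Q (Icc a b) := fun t ht => (hQd t ht).continuousWithinAt
  have hewQ : ContinuousOn (fun t => (w t : 𝕜) * e t + Q t) (Icc a b) :=
    (hwk.continuousOn.mul hec).add hQc
  have hmi : IntervalIntegrable (fun t => deriv e t - ((w t : 𝕜) * e t + Q t)) volume a b :=
    hei.sub (ContinuousOn.intervalIntegrable (huIcc ▸ hewQ))
  obtain ⟨c, hc⟩ := exists_ae_eq_const_of_integral_mul_eq_zero hab hmi (fun g hg hg0 => by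
    have hgk : Continuous fun t => (g t : 𝕜) := RCLike.continuous_ofReal.comp hg
    -- The primitive of a mean-zero `g` vanishes at both ends, so it is an admissible test function
    -- with derivative `g`.
    set h : ℝ → 𝕜 := (Icc a b).indicator fun x => ∫ t in a..x, (g t : 𝕜) with hh
    have hheq : EqOn h (fun x => ∫ t in a..x, (g t : 𝕜)) (Icc a b) := fun x hx =>
      indicator_of_mem hx _
    have hhd : ∀ t ∈ Icc a b, HasDerivWithinAt h (g t : 𝕜) (Icc a b) t := fun t ht =>
      (hgk.continuousOn.hasDerivWithinAt_primitive ht).congr hheq (hheq ht)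
    have hha : h a = 0 := by rw [hheq (left_mem_Icc.2 hab.le)]; simp
    have hhb : h b = 0 := by
      rw [hheq (right_mem_Icc.2 hab.le)]
      change ∫ t in a..b, (g t : 𝕜) = 0
      rw [intervalIntegral_ofReal_rclike, hg0, RCLike.ofReal_zero]
    have hhc : ContinuousOn h (Icc a b) := fun t ht => (hhd t ht).continuousWithinAt
    have hmem : h ∈ sobolevH1 𝕜 a b :=
      mem_sobolevH1_of_hasDerivWithinAt hab.le hhd hgk.continuousOn hha hhb
        fun t ht => indicator_of_notMem ht _
    have hdh : ∀ x ∈ Ioo a b, deriv h x = (g x : 𝕜) := fun x hx =>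
      ((hhd x (Ioo_subset_Icc_self hx)).hasDerivAt_of_mem_Ioo hx).deriv
    have hweak := hweak h hmem
    unfold weakForm pairing at hweak
    have k1 : ∫ t in a..b, deriv e t * deriv h t = ∫ t in a..b, deriv e t * (g t : 𝕜) :=
      intervalIntegral.integral_congr_ae
        (ae_uIoc_of_forall_Ioo hab.le fun x hx => by rw [hdh x hx])
    have k2 : ∫ t in a..b, e t * deriv h t * (w t : 𝕜) = ∫ t in a..b, e t * (g t : 𝕜) * (w t : 𝕜) :=
      intervalIntegral.integral_congr_ae
        (ae_uIoc_of_forall_Ioo hab.le fun x hx => by rw [hdh x hx])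
    have hi1 : IntervalIntegrable (fun t => deriv e t * (g t : 𝕜)) volume a b :=
      hei.mul_continuousOn hgk.continuousOn
    have hi2 : IntervalIntegrable (fun t => e t * (g t : 𝕜) * (w t : 𝕜)) volume a b :=
      ContinuousOn.intervalIntegrable
        (huIcc ▸ (hec.mul hgk.continuousOn).mul hwk.continuousOn)
    have hi3 : IntervalIntegrable (fun t => μ * e t * h t) volume a b :=
      ContinuousOn.intervalIntegrable (huIcc ▸ hμe.mul hhc)
    have hi4 : IntervalIntegrable (fun t => Q t * (g t : 𝕜)) volume a b :=
      ContinuousOn.intervalIntegrable (huIcc ▸ hQc.mul hgk.continuousOn)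
    have k3 : ∫ t in a..b, (μ * e t * h t + Q t * (g t : 𝕜)) = 0 := by
      rw [integral_eq_sub_of_hasDerivWithinAt_Icc (f := fun t => Q t * h t) hab.le
        (fun x hx => (hQd x hx).mul (hhd x hx))
        ((hμe.mul hhc).add (hQc.mul hgk.continuousOn)), hha, hhb]
      simp
    rw [intervalIntegral.integral_add hi3 hi4] at k3
    rw [k1, k2, eq_neg_of_add_eq_zero_left k3] at hweak
    calc ∫ t in a..b, (deriv e t - ((w t : 𝕜) * e t + Q t)) * (g t : 𝕜)
        = ∫ t in a..b, (deriv e t * (g t : 𝕜) - e t * (g t : 𝕜) * (w t : 𝕜) - Q t * (g t : 𝕜)) := by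
          congr 1; ext t; ring
      _ = 0 := by
          rw [intervalIntegral.integral_sub (hi1.sub hi2) hi4,
            intervalIntegral.integral_sub hi1 hi2]
          linear_combination -hweak)
  have hq : ContinuousOn (fun t => (w t : 𝕜) * e t + (Q t + c)) (Icc a b) :=
    (hwk.continuousOn.mul hec).add (hQc.add continuousOn_const)
  -- The equation for `e'` holds only almost everywhere; writing `e` as the primitive of a
  -- continuous function upgrades it to every point.
  have heq : EqOn e (fun x => ∫ t in a..x, ((w t : 𝕜) * e t + (Q t + c))) (Icc a b) := by
    intro x hx
    have hs : uIcc a x ⊆ uIcc a b := by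
      rw [uIcc_of_le hx.1, huIcc]; exact Icc_subset_Icc_right hx.2
    have h1 := (heac.mono hs).integral_deriv_eq_sub_rclike (hei.mono_set hs)
    rw [hea, sub_zero] at h1
    rw [← h1]
    refine intervalIntegral.integral_congr_ae ?_
    have hb : ∀ᵐ t : ℝ, t ≠ b := by simp [ae_iff, measure_singleton]
    filter_upwards [hc, hb] with t ht htb htx
    rw [uIoc_of_le hx.1] at htx
    have := ht ⟨htx.1, lt_of_le_of_ne (htx.2.trans hx.2) htb⟩
    linear_combination this
  exact ⟨fun t => Q t + c, hea, heb,
    fun t ht => (hq.hasDerivWithinAt_primitive ht).congr heq (heq ht),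
    fun t ht => (hQd t ht).add_const c⟩

end Weak

/-! ### Bessel's inequality in a weighted space. -/

section Bessel

open Set Filter Topology

variable {𝕜 : Type*} [RCLike 𝕜] {a b : ℝ}

theorem intervalIntegral_conj_rclike (f : ℝ → 𝕜) :
    ∫ t in a..b, starRingEnd 𝕜 (f t) = starRingEnd 𝕜 (∫ t in a..b, f t) := by
  simp only [intervalIntegral, integral_conj, map_sub]

/-- A form of **Bessel's inequality**: primitives of functions that are orthogonal with respect to a
weight `σ` satisfy a pointwise square function bound. -/
theorem sum_norm_primitive_sq_div_le {ι : Type*} (s : Finset ι) {σ : ℝ → ℝ} {G : ι → ℝ → 𝕜}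
    {ν : ι → ℝ} (hab : a ≤ b) (hσ : ContinuousOn σ (Icc a b)) (hσ0 : ∀ t ∈ Icc a b, 0 ≤ σ t)
    (hG : ∀ i ∈ s, ContinuousOn (G i) (Icc a b)) (hν : ∀ i ∈ s, 0 < ν i)
    (hself : ∀ i ∈ s, ∫ t in a..b, (σ t : 𝕜) * (G i t * starRingEnd 𝕜 (G i t)) = (ν i : 𝕜))
    (horth : ∀ i ∈ s, ∀ j ∈ s, i ≠ j →
      ∫ t in a..b, (σ t : 𝕜) * (G i t * starRingEnd 𝕜 (G j t)) = 0)
    {x : ℝ} (hx : x ∈ Icc a b) :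
    ∑ i ∈ s, ‖∫ t in a..x, (σ t : 𝕜) * G i t‖ ^ 2 / ν i ≤ ∫ t in a..b, σ t := by
  have huIcc := uIcc_of_le hab
  have hσk : ContinuousOn (fun t => (σ t : 𝕜)) (Icc a b) :=
    RCLike.continuous_ofReal.comp_continuousOn hσ
  set A : ι → 𝕜 := fun i => ∫ t in a..x, (σ t : 𝕜) * G i t with hA
  set c : ι → 𝕜 := fun i => A i / (ν i : 𝕜) with hc
  -- `S` is the orthogonal projection in `L²(σ)` of the indicator of `[a, x]` onto the span of the
  -- `G i`. Hence `B` is both the integral of `σ S` over `[a, x]` and the squared norm of `S`.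
  set S : ℝ → 𝕜 := fun t => ∑ i ∈ s, starRingEnd 𝕜 (c i) * G i t with hS
  set B : ℝ := ∑ i ∈ s, ‖A i‖ ^ 2 / ν i with hB
  have hSc : ContinuousOn S (Icc a b) :=
    continuousOn_finsetSum _ fun i hi => continuousOn_const.mul (hG i hi)
  have hsub : Icc a x ⊆ Icc a b := Icc_subset_Icc_right hx.2
  have hBx : (B : 𝕜) = ∫ t in a..x, (σ t : 𝕜) * S t := by
    have : ∀ t, (σ t : 𝕜) * S t = ∑ i ∈ s, starRingEnd 𝕜 (c i) * ((σ t : 𝕜) * G i t) := by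
      intro t
      rw [hS, Finset.mul_sum]
      exact Finset.sum_congr rfl fun i _ => by ring
    simp only [this]
    rw [intervalIntegral.integral_finsetSum fun i hi => ContinuousOn.intervalIntegrable ?_]
    · simp only [intervalIntegral.integral_const_mul]
      rw [hB]
      push_cast
      refine Finset.sum_congr rfl fun i hi => ?_
      change _ = starRingEnd 𝕜 (c i) * A i
      rw [hc]
      simp only [map_div₀, RCLike.conj_ofReal]
      rw [← RCLike.conj_mul]
      ring
    · rw [uIcc_of_le hx.1]
      exact (continuousOn_const.mul (hσk.mul (hG i hi))).mono hsub
  have hBB : (∫ t in a..b, σ t * ‖S t‖ ^ 2) = B := by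
    have h1 : ((∫ t in a..b, σ t * ‖S t‖ ^ 2 : ℝ) : 𝕜)
        = ∫ t in a..b, ∑ i ∈ s, ∑ j ∈ s, (starRingEnd 𝕜 (c i) * c j) *
            ((σ t : 𝕜) * (G i t * starRingEnd 𝕜 (G j t))) := by
      rw [← intervalIntegral_ofReal_rclike]
      congr 1
      ext t
      push_cast
      rw [← RCLike.mul_conj, hS]
      simp only [map_sum, map_mul, RCLike.conj_conj]
      rw [Finset.sum_mul_sum, Finset.mul_sum]
      refine Finset.sum_congr rfl fun i _ => ?_
      rw [Finset.mul_sum]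
      exact Finset.sum_congr rfl fun j _ => by ring
    have hint : ∀ i ∈ s, ∀ j ∈ s, IntervalIntegrable (fun t => (starRingEnd 𝕜 (c i) * c j) *
            ((σ t : 𝕜) * (G i t * starRingEnd 𝕜 (G j t)))) volume a b := by
      intro i hi j hj
      refine ContinuousOn.intervalIntegrable ?_
      rw [huIcc]
      exact continuousOn_const.mul
        (hσk.mul ((hG i hi).mul (RCLike.continuous_conj.comp_continuousOn (hG j hj))))
    have h2 : ((∫ t in a..b, σ t * ‖S t‖ ^ 2 : ℝ) : 𝕜) = (B : 𝕜) := by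
      rw [h1, intervalIntegral.integral_finsetSum fun i hi => by
        simpa only [Finset.sum_fn] using IntervalIntegrable.sum s (hint i hi)]
      rw [hB]
      push_cast
      refine Finset.sum_congr rfl fun i hi => ?_
      rw [intervalIntegral.integral_finsetSum (hint i hi), Finset.sum_eq_single i]
      · rw [intervalIntegral.integral_const_mul, hself i hi, hc]
        have : (ν i : 𝕜) ≠ 0 := RCLike.ofReal_ne_zero.2 (hν i hi).ne'
        simp only [map_div₀, RCLike.conj_ofReal]
        rw [← RCLike.conj_mul]
        field_simp
      · intro j hj hji
        rw [intervalIntegral.integral_const_mul, horth i hi j hj hji.symm, mul_zero]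
      · exact fun h => absurd hi h
    exact_mod_cast h2
  have hB0 : 0 ≤ B := Finset.sum_nonneg fun i hi => div_nonneg (sq_nonneg _) (hν i hi).le
  have hi1 : ContinuousOn (fun t => σ t * ‖S t‖) (Icc a b) := hσ.mul hSc.norm
  have hi2 : ContinuousOn (fun t => σ t * ‖S t‖ ^ 2) (Icc a b) := hσ.mul (hSc.norm.pow 2)
  have h1 : B ≤ ∫ t in a..x, σ t * ‖S t‖ := by
    calc B = ‖(B : 𝕜)‖ := by rw [RCLike.norm_ofReal, abs_of_nonneg hB0]
      _ ≤ ∫ t in a..x, ‖(σ t : 𝕜) * S t‖ := by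
          rw [hBx]; exact intervalIntegral.norm_integral_le_integral_norm hx.1
      _ = ∫ t in a..x, σ t * ‖S t‖ := by
          refine intervalIntegral.integral_congr fun t ht => ?_
          rw [uIcc_of_le hx.1] at ht
          simp only [norm_mul, RCLike.norm_ofReal, abs_of_nonneg (hσ0 t (hsub ht))]
  have h2 : ∫ t in a..x, σ t * ‖S t‖ ≤ ∫ t in a..b, σ t * ‖S t‖ := by
    refine intervalIntegral.integral_mono_interval le_rfl hx.1 hx.2 ?_
      (ContinuousOn.intervalIntegrable (huIcc ▸ hi1))
    exact (ae_restrict_iff' measurableSet_Ioc).2 (.of_forall fun t ht =>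
      mul_nonneg (hσ0 t (Ioc_subset_Icc_self ht)) (norm_nonneg _))
  -- From `‖S‖ ≤ (1 + ‖S‖²) / 2` one gets `B ≤ (∫ σ) / 2 + B / 2`, which replaces Cauchy–Schwarz.
  have h3 : ∫ t in a..b, σ t * ‖S t‖ ≤ ∫ t in a..b, ((1 / 2) * σ t + (1 / 2) * (σ t * ‖S t‖ ^ 2)) := by
    refine intervalIntegral.integral_mono_on hab
      (ContinuousOn.intervalIntegrable (huIcc ▸ hi1))
      (ContinuousOn.intervalIntegrable
        (huIcc ▸ (continuousOn_const.mul hσ).add (continuousOn_const.mul hi2))) fun t ht => ?_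
    nlinarith [mul_nonneg (hσ0 t ht) (sq_nonneg (‖S t‖ - 1))]
  rw [intervalIntegral.integral_add
      (ContinuousOn.intervalIntegrable (huIcc ▸ continuousOn_const.mul hσ))
      (ContinuousOn.intervalIntegrable (huIcc ▸ continuousOn_const.mul hi2)),
    intervalIntegral.integral_const_mul, intervalIntegral.integral_const_mul, hBB] at h3
  linarith

end Bessel

/-! ### Symmetry for the weight `exp (-∫ w)`. -/

section Orthogonality

open Set Filter Topology

/-- The weight `exp (-∫ w)` which makes the operator symmetric. -/
noncomputable def integratingFactor (a : ℝ) (w : ℝ → ℝ) (t : ℝ) : ℝ :=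
  Real.exp (-∫ s in a..t, w s)

theorem integratingFactor_pos (a : ℝ) (w : ℝ → ℝ) (t : ℝ) : 0 < integratingFactor a w t :=
  Real.exp_pos _

theorem hasDerivAt_integratingFactor {a : ℝ} {w : ℝ → ℝ} (hw : Continuous w) (t : ℝ) :
    HasDerivAt (integratingFactor a w) (-(w t) * integratingFactor a w t) t := by
  have := (hw.integral_hasStrictDerivAt a t).hasDerivAt.neg.exp
  rw [mul_comm] at this
  exact this

theorem continuous_integratingFactor {a : ℝ} {w : ℝ → ℝ} (hw : Continuous w) :
    Continuous (integratingFactor a w) :=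
  continuous_iff_continuousAt.2 fun t => (hasDerivAt_integratingFactor hw t).continuousAt

variable {𝕜 : Type*} [RCLike 𝕜] {a b : ℝ} {w : ℝ → ℝ} {μ μ' : 𝕜} {e q e' q' : ℝ → 𝕜}

theorem HasDerivAt.ofReal_comp_rclike {f : ℝ → ℝ} {f' x : ℝ} (hf : HasDerivAt f f' x) :
    HasDerivAt (fun t => (f t : 𝕜)) (f' : 𝕜) x := by
  simpa using! (RCLike.ofRealCLM (K := 𝕜)).hasFDerivAt.comp_hasDerivAt x hf

theorem HasDerivWithinAt.ofReal_comp_rclike {f : ℝ → ℝ} {f' x : ℝ} {s : Set ℝ}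
    (hf : HasDerivWithinAt f f' s x) :
    HasDerivWithinAt (fun t => (f t : 𝕜)) (f' : 𝕜) s x := by
  simpa using! (RCLike.ofRealCLM (K := 𝕜)).hasFDerivAt.comp_hasDerivWithinAt x hf

theorem HasDerivWithinAt.conj_rclike {f : ℝ → 𝕜} {f' : 𝕜} {x : ℝ} {s : Set ℝ}
    (hf : HasDerivWithinAt f f' s x) :
    HasDerivWithinAt (fun t => starRingEnd 𝕜 (f t)) (starRingEnd 𝕜 f') s x := by
  simpa using! (RCLike.conjCLE (K := 𝕜)).hasFDerivAt.comp_hasDerivWithinAt x hf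

/-- The factor satisfies `σ' = -w σ`, which cancels the term `w e`. -/
theorem IsDirichletSolution.hasDerivWithinAt_integratingFactor_mul (hw : Continuous w)
    (h : IsDirichletSolution a b w μ e q) {t : ℝ} (ht : t ∈ Icc a b) :
    HasDerivWithinAt (fun t => (integratingFactor a w t : 𝕜) * e t)
      ((integratingFactor a w t : 𝕜) * q t) (Icc a b) t := by
  have h1 : HasDerivAt (fun t => (integratingFactor a w t : 𝕜)) _ t :=
    (hasDerivAt_integratingFactor (a := a) hw t).ofReal_comp_rclike
  refine (h1.hasDerivWithinAt.mul (h.deriv_fst t ht)).congr_deriv ?_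
  push_cast
  ring

/-- Integrate the derivative of `q · conj (σ e')` over `[a, b]`, where `e'` is the second solution;
the boundary terms vanish with `e'`. -/
theorem IsDirichletSolution.integral_mul_conj (hab : a ≤ b) (hw : Continuous w)
    (h : IsDirichletSolution a b w μ e q) (h' : IsDirichletSolution a b w μ' e' q') :
    ∫ t in a..b, (integratingFactor a w t : 𝕜) * (q t * starRingEnd 𝕜 (q' t))
      = -μ * ∫ t in a..b, (integratingFactor a w t : 𝕜) * (e t * starRingEnd 𝕜 (e' t)) := by
  have huIcc := uIcc_of_le hab
  have hσ : ContinuousOn (fun t => (integratingFactor a w t : 𝕜)) (Icc a b) :=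
    (RCLike.continuous_ofReal.comp (continuous_integratingFactor hw)).continuousOn
  have hce := RCLike.continuous_conj.comp_continuousOn h'.continuousOn_fst
  have hcq := RCLike.continuous_conj.comp_continuousOn h'.continuousOn_snd
  have hd : ∀ t ∈ Icc a b, HasDerivWithinAt
      (fun t => q t * starRingEnd 𝕜 ((integratingFactor a w t : 𝕜) * e' t))
      (μ * ((integratingFactor a w t : 𝕜) * (e t * starRingEnd 𝕜 (e' t)))
        + (integratingFactor a w t : 𝕜) * (q t * starRingEnd 𝕜 (q' t))) (Icc a b) t := by
    intro t ht
    refine ((h.deriv_snd t ht).mul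
      (h'.hasDerivWithinAt_integratingFactor_mul hw ht).conj_rclike).congr_deriv ?_
    simp only [map_mul, RCLike.conj_ofReal]
    ring
  have hc1 : ContinuousOn (fun t => μ * ((integratingFactor a w t : 𝕜) *
      (e t * starRingEnd 𝕜 (e' t)))) (Icc a b) :=
    continuousOn_const.mul (hσ.mul (h.continuousOn_fst.mul hce))
  have hc2 : ContinuousOn (fun t => (integratingFactor a w t : 𝕜) *
      (q t * starRingEnd 𝕜 (q' t))) (Icc a b) :=
    hσ.mul (h.continuousOn_snd.mul hcq)
  have := integral_eq_sub_of_hasDerivWithinAt_Icc hab hd (hc1.add hc2)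
  rw [intervalIntegral.integral_add (ContinuousOn.intervalIntegrable (huIcc ▸ hc1))
    (ContinuousOn.intervalIntegrable (huIcc ▸ hc2)), intervalIntegral.integral_const_mul,
    h'.left, h'.right] at this
  simp only [mul_zero, map_zero, sub_zero] at this
  linear_combination this

theorem conj_integral_ofReal_mul_mul_conj (σ : ℝ → ℝ) (f g : ℝ → 𝕜) :
    starRingEnd 𝕜 (∫ t in a..b, (σ t : 𝕜) * (f t * starRingEnd 𝕜 (g t)))
      = ∫ t in a..b, (σ t : 𝕜) * (g t * starRingEnd 𝕜 (f t)) := by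
  rw [← intervalIntegral_conj_rclike]
  congr 1
  ext t
  simp only [map_mul, RCLike.conj_ofReal, RCLike.conj_conj]
  ring

/-- Compare the previous identity with the conjugate of the one for the exchanged pair. For a single
solution it gives real eigenvalues, for two distinct eigenvalues orthogonality. -/
theorem IsDirichletSolution.sub_conj_mul_integral (hab : a ≤ b) (hw : Continuous w)
    (h : IsDirichletSolution a b w μ e q) (h' : IsDirichletSolution a b w μ' e' q') :
    (μ - starRingEnd 𝕜 μ') *
      ∫ t in a..b, (integratingFactor a w t : 𝕜) * (e t * starRingEnd 𝕜 (e' t)) = 0 := by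
  have h1 := h.integral_mul_conj hab hw h'
  have h2 := congrArg (starRingEnd 𝕜) (h'.integral_mul_conj hab hw h)
  rw [map_mul, map_neg, conj_integral_ofReal_mul_mul_conj, conj_integral_ofReal_mul_mul_conj] at h2
  linear_combination h1 - h2

theorem integral_ofReal_mul_mul_conj (σ : ℝ → ℝ) (f : ℝ → 𝕜) :
    ∫ t in a..b, (σ t : 𝕜) * (f t * starRingEnd 𝕜 (f t))
      = ((∫ t in a..b, σ t * ‖f t‖ ^ 2 : ℝ) : 𝕜) := by
  rw [← intervalIntegral_ofReal_rclike]
  simp only [RCLike.mul_conj]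
  push_cast
  rfl

theorem integral_weight_mul_norm_sq_pos {σ : ℝ → ℝ} (hab : a < b) (hσ : Continuous σ)
    (hσ0 : ∀ t, 0 < σ t) (he : ContinuousOn e (Icc a b)) (h0 : ∀ t, t ∉ Icc a b → e t = 0)
    (hne : e ≠ 0) : 0 < ∫ t in a..b, σ t * ‖e t‖ ^ 2 := by
  obtain ⟨x, hx⟩ := Function.ne_iff.1 hne
  have hxI : x ∈ Icc a b := by
    by_contra hcon
    exact hx (h0 x hcon)
  refine intervalIntegral.integral_pos hab (hσ.continuousOn.mul (he.norm.pow 2))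
    (fun t _ => mul_nonneg (hσ0 t).le (sq_nonneg _))
    ⟨x, hxI, mul_pos (hσ0 x) (pow_pos (norm_pos_iff.2 hx) 2)⟩

theorem conj_eq_of_mem_weakEigenvalues (hab : a < b) (hw : Continuous w)
    (hμ : μ ∈ weakEigenvalues 𝕜 a b w) : starRingEnd 𝕜 μ = μ := by
  obtain ⟨e, he⟩ := hμ
  obtain ⟨q, h⟩ := exists_isDirichletSolution_of_mem_weakEigenfunctions hab hw he
  have h1 := h.sub_conj_mul_integral hab.le hw h
  rw [integral_ofReal_mul_mul_conj] at h1
  have hpos := integral_weight_mul_norm_sq_pos hab (continuous_integratingFactor (a := a) hw)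
    (integratingFactor_pos a w) h.continuousOn_fst he.1.2.2.2.1 he.2.1
  exact (sub_eq_zero.1 ((mul_eq_zero.1 h1).resolve_right
    (RCLike.ofReal_ne_zero.2 hpos.ne'))).symm

end Orthogonality

/-! ### Finiteness in bounded sets and simplicity of eigenvalues. -/

section Discreteness

open Set Filter Topology

variable {𝕜 : Type*} [RCLike 𝕜] {a b : ℝ} {w : ℝ → ℝ} {μ : 𝕜} {e q : ℝ → 𝕜}

/-- Bessel's inequality for the functions `q`, with `ν = ‖μ‖ ∫ σ ‖e‖²`, controls `∑ ‖σ(x) e(x)‖² /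
ν` by `∫ σ` at each `x`; dividing by `σ(x)` and integrating over `x` leaves `‖μ‖⁻¹` from each term.
-/
theorem sum_inv_norm_weakEigenvalues_le (hab : a < b) (hw : Continuous w) (s : Finset 𝕜)
    (hs : ∀ μ ∈ s, μ ∈ weakEigenvalues 𝕜 a b w ∧ μ ≠ 0) :
    ∑ μ ∈ s, ‖μ‖⁻¹ ≤
      (∫ t in a..b, integratingFactor a w t) * ∫ t in a..b, (integratingFactor a w t)⁻¹ := by
  classical
  have hex : ∀ μ : 𝕜, ∃ eq : (ℝ → 𝕜) × (ℝ → 𝕜), μ ∈ s →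
      eq.1 ∈ weakEigenfunctions 𝕜 a b w μ ∧ IsDirichletSolution a b w μ eq.1 eq.2 := by
    intro μ
    by_cases hμ : μ ∈ s
    · obtain ⟨e, he⟩ := (hs μ hμ).1
      obtain ⟨q, h⟩ := exists_isDirichletSolution_of_mem_weakEigenfunctions hab hw he
      exact ⟨(e, q), fun _ => ⟨he, h⟩⟩
    · exact ⟨(0, 0), fun h => absurd h hμ⟩
  choose F hF using hex
  set σ := integratingFactor a w with hσdef
  have hσc : Continuous σ := continuous_integratingFactor hw
  have hσ0 : ∀ t, 0 < σ t := integratingFactor_pos a w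
  have hσi : Continuous fun t => (σ t)⁻¹ := hσc.inv₀ fun t => (hσ0 t).ne'
  set n : 𝕜 → ℝ := fun μ => ∫ t in a..b, σ t * ‖(F μ).1 t‖ ^ 2 with hn
  have hnpos : ∀ μ ∈ s, 0 < n μ := fun μ hμ =>
    integral_weight_mul_norm_sq_pos hab hσc hσ0 (hF μ hμ).2.continuousOn_fst
      (hF μ hμ).1.1.2.2.2.1 (hF μ hμ).1.2.1
  have hνeq : ∀ μ ∈ s, ∫ t in a..b, σ t * ‖(F μ).2 t‖ ^ 2 = ‖μ‖ * n μ := by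
    intro μ hμ
    have h1 := (hF μ hμ).2.integral_mul_conj hab.le hw (hF μ hμ).2
    rw [integral_ofReal_mul_mul_conj, integral_ofReal_mul_mul_conj] at h1
    have h2 := congrArg norm h1
    rw [norm_mul, norm_neg, RCLike.norm_ofReal, RCLike.norm_ofReal, abs_of_pos (hnpos μ hμ),
      abs_of_nonneg] at h2
    · exact h2
    · exact intervalIntegral.integral_nonneg hab.le fun t _ =>
        mul_nonneg (hσ0 t).le (sq_nonneg _)
  have hbessel : ∀ x ∈ Icc a b,
      ∑ μ ∈ s, σ x * ‖(F μ).1 x‖ ^ 2 / (‖μ‖ * n μ) ≤ (∫ t in a..b, σ t) * (σ x)⁻¹ := by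
    intro x hx
    have h1 := sum_norm_primitive_sq_div_le s (σ := σ) (G := fun μ => (F μ).2)
      (ν := fun μ => ‖μ‖ * n μ) hab.le hσc.continuousOn (fun t _ => (hσ0 t).le)
      (fun μ hμ => (hF μ hμ).2.continuousOn_snd)
      (fun μ hμ => mul_pos (norm_pos_iff.2 (hs μ hμ).2) (hnpos μ hμ))
      (fun μ hμ => by rw [integral_ofReal_mul_mul_conj, hνeq μ hμ])
      (fun μ hμ μ' hμ' hne => by
        rw [(hF μ hμ).2.integral_mul_conj hab.le hw (hF μ' hμ').2]
        have h2 := (hF μ hμ).2.sub_conj_mul_integral hab.le hw (hF μ' hμ').2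
        rw [conj_eq_of_mem_weakEigenvalues hab hw (hs μ' hμ').1] at h2
        rw [(mul_eq_zero.1 h2).resolve_left (sub_ne_zero.2 hne), mul_zero]) hx
    refine le_trans (le_of_eq ?_) (mul_le_mul_of_nonneg_right h1 (inv_nonneg.2 (hσ0 x).le))
    rw [Finset.sum_mul]
    refine Finset.sum_congr rfl fun μ hμ => ?_
    have hprim := eq_primitive_of_hasDerivWithinAt_Icc
      (fun t ht => (hF μ hμ).2.hasDerivWithinAt_integratingFactor_mul hw ht)
      ((RCLike.continuous_ofReal.comp hσc).continuousOn.mul (hF μ hμ).2.continuousOn_snd) hx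
    have hprim' : ∫ t in a..x, (σ t : 𝕜) * (F μ).2 t = (σ x : 𝕜) * (F μ).1 x := by
      simpa [(hF μ hμ).2.left] using hprim
    rw [hprim', norm_mul, RCLike.norm_ofReal, abs_of_pos (hσ0 x)]
    have := (hσ0 x).ne'
    field_simp
  have hint : ∀ μ ∈ s, ContinuousOn (fun x => σ x * ‖(F μ).1 x‖ ^ 2 / (‖μ‖ * n μ)) (Icc a b) :=
    fun μ hμ => (hσc.continuousOn.mul ((hF μ hμ).2.continuousOn_fst.norm.pow 2)).div_const _
  have huIcc := uIcc_of_le hab.le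
  have hmono := intervalIntegral.integral_mono_on (μ := volume)
    (g := fun x => (∫ t in a..b, σ t) * (σ x)⁻¹) hab.le
    (ContinuousOn.intervalIntegrable (huIcc ▸ continuousOn_finsetSum s hint))
    ((continuous_const.mul hσi).intervalIntegrable _ _) hbessel
  rw [intervalIntegral.integral_const_mul, intervalIntegral.integral_finsetSum fun μ hμ =>
    ContinuousOn.intervalIntegrable (huIcc ▸ hint μ hμ)] at hmono
  refine le_trans (le_of_eq (Finset.sum_congr rfl fun μ hμ => ?_)) hmono
  rw [intervalIntegral.integral_div]
  change _ = n μ / (‖μ‖ * n μ)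
  have h1 := (hnpos μ hμ).ne'
  have h2 := norm_ne_zero_iff.2 (hs μ hμ).2
  field_simp

theorem finite_weakEigenvalues_norm_le (hab : a < b) (hw : Continuous w) (R : ℝ) :
    {μ : 𝕜 | μ ∈ weakEigenvalues 𝕜 a b w ∧ ‖μ‖ ≤ R}.Finite := by
  set T : Set 𝕜 := {μ | (μ ∈ weakEigenvalues 𝕜 a b w ∧ μ ≠ 0) ∧ ‖μ‖ ≤ R} with hT
  set C : ℝ := (∫ t in a..b, integratingFactor a w t) * ∫ t in a..b, (integratingFactor a w t)⁻¹
  suffices hfin : T.Finite by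
    refine (hfin.insert 0).subset fun μ hμ => ?_
    by_cases h0 : μ = 0
    · exact Or.inl h0
    · exact Or.inr ⟨⟨hμ.1, h0⟩, hμ.2⟩
  by_contra hinf
  obtain ⟨N, hN⟩ := exists_nat_gt (C * R)
  obtain ⟨s, hsT, hsN⟩ := Set.Infinite.exists_subset_card_eq hinf (N + 1)
  have hle := sum_inv_norm_weakEigenvalues_le hab hw s fun μ hμ => (hsT hμ).1
  obtain ⟨μ₀, hμ₀⟩ : s.Nonempty := Finset.card_pos.1 (by omega)
  have hR : 0 < R := (norm_pos_iff.2 (hsT hμ₀).1.2).trans_le (hsT hμ₀).2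
  have h1 : (s.card : ℝ) * R⁻¹ ≤ ∑ μ ∈ s, ‖μ‖⁻¹ := by
    rw [← nsmul_eq_mul]
    refine Finset.card_nsmul_le_sum s _ _ fun μ hμ => ?_
    exact inv_anti₀ (norm_pos_iff.2 (hsT hμ).1.2) (hsT hμ).2
  have h2 : (s.card : ℝ) ≤ C * R := by
    have := mul_le_mul_of_nonneg_right (h1.trans hle) hR.le
    rwa [mul_assoc, inv_mul_cancel₀ hR.ne', mul_one] at this
  rw [hsN] at h2
  push_cast at h2
  linarith

theorem countable_weakEigenvalues (hab : a < b) (hw : Continuous w) :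
    (weakEigenvalues 𝕜 a b w).Countable := by
  have : weakEigenvalues 𝕜 a b w ⊆
      ⋃ n : ℕ, {μ : 𝕜 | μ ∈ weakEigenvalues 𝕜 a b w ∧ ‖μ‖ ≤ n} := fun μ hμ => by
    obtain ⟨n, hn⟩ := exists_nat_ge ‖μ‖
    exact mem_iUnion.2 ⟨n, hμ, hn⟩
  exact (countable_iUnion fun n : ℕ =>
    (finite_weakEigenvalues_norm_le hab hw n).countable).mono this

theorem HasDerivWithinAt.Ici_of_Icc {E : Type*} [NormedAddCommGroup E] [NormedSpace ℝ E]
    {f : ℝ → E} {f' : E} {t : ℝ} (h : HasDerivWithinAt f f' (Icc a b) t) (ht : t ∈ Ico a b) :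
    HasDerivWithinAt f f' (Ici t) t :=
  h.mono_of_mem_nhdsWithin
    (mem_of_superset (Icc_mem_nhdsGE ht.2) (Icc_subset_Icc_left ht.1))

/-- Uniqueness for the linear system with zero initial data `(e, q)`, by Grönwall's inequality. -/
theorem IsDirichletSolution.eq_zero (hw : Continuous w) (h : IsDirichletSolution a b w μ e q)
    (hq : q a = 0) {t : ℝ} (ht : t ∈ Icc a b) : e t = 0 := by
  obtain ⟨C, hC⟩ := isCompact_Icc.exists_bound_of_continuousOn (hw.continuousOn (s := Icc a b))
  have key : (e t, q t) = 0 := by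
    refine eq_zero_of_abs_deriv_le_mul_abs_self_of_eq_zero_right (K := C + 1 + ‖μ‖)
      (f := fun t => (e t, q t)) (f' := fun t => ((w t : 𝕜) * e t + q t, μ * e t))
      (h.continuousOn_fst.prodMk h.continuousOn_snd)
      (fun x hx => ((h.deriv_fst x (Ico_subset_Icc_self hx)).Ici_of_Icc hx).prodMk
        ((h.deriv_snd x (Ico_subset_Icc_self hx)).Ici_of_Icc hx))
      (by simp [h.left, hq]) (fun x hx => ?_) t ht
    have h1 : ‖e x‖ ≤ ‖(e x, q x)‖ := norm_fst_le (e x, q x)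
    have h2 : ‖q x‖ ≤ ‖(e x, q x)‖ := norm_snd_le (e x, q x)
    have h3 := hC x (Ico_subset_Icc_self hx)
    have hC0 : 0 ≤ C := (norm_nonneg _).trans h3
    have hp := norm_nonneg (e x, q x)
    refine (Prod.norm_def _).trans_le (max_le ?_ ?_)
    · calc ‖(w x : 𝕜) * e x + q x‖ ≤ ‖w x‖ * ‖e x‖ + ‖q x‖ := by
            refine (norm_add_le _ _).trans_eq ?_
            rw [norm_mul, RCLike.norm_ofReal, Real.norm_eq_abs]
        _ ≤ C * ‖(e x, q x)‖ + ‖(e x, q x)‖ := by gcongr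
        _ ≤ _ := by nlinarith [mul_nonneg (norm_nonneg μ) hp]
    · calc ‖μ * e x‖ ≤ ‖μ‖ * ‖(e x, q x)‖ := by rw [norm_mul]; gcongr
        _ ≤ _ := by nlinarith [mul_nonneg hC0 hp]
  exact congrArg Prod.fst key

theorem finiteDimensional_span_weakEigenfunctions (hab : a < b) (hw : Continuous w) (μ : 𝕜) :
    FiniteDimensional 𝕜 (Submodule.span 𝕜 (weakEigenfunctions 𝕜 a b w μ)) := by
  rcases (weakEigenfunctions 𝕜 a b w μ).eq_empty_or_nonempty with hemp | ⟨e₀, he₀⟩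
  · rw [hemp, Submodule.span_empty]
    infer_instance
  obtain ⟨q₀, h₀⟩ := exists_isDirichletSolution_of_mem_weakEigenfunctions hab hw he₀
  have hq₀ : q₀ a ≠ 0 := fun hq => he₀.2.1 <| funext fun t => by
    by_cases ht : t ∈ Icc a b
    · exact h₀.eq_zero hw hq ht
    · exact he₀.1.2.2.2.1 t ht
  have hsub : weakEigenfunctions 𝕜 a b w μ ⊆ Submodule.span 𝕜 {e₀} := by
    intro e he
    obtain ⟨q, h⟩ := exists_isDirichletSolution_of_mem_weakEigenfunctions hab hw he
    -- This ratio makes the quasi-derivative of `e - (q a / q₀ a) e₀` vanish at `a`.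
    refine Submodule.mem_span_singleton.2 ⟨q a / q₀ a, funext fun t => ?_⟩
    rw [Pi.smul_apply, smul_eq_mul]
    by_cases ht : t ∈ Icc a b
    · have hd : IsDirichletSolution a b w μ (fun t => e t - q a / q₀ a * e₀ t)
          (fun t => q t - q a / q₀ a * q₀ t) :=
        { left := by simp [h.left, h₀.left]
          right := by simp [h.right, h₀.right]
          deriv_fst := fun t ht => ((h.deriv_fst t ht).sub
            ((h₀.deriv_fst t ht).const_mul _)).congr_deriv (by ring)
          deriv_snd := fun t ht => ((h.deriv_snd t ht).sub
            ((h₀.deriv_snd t ht).const_mul _)).congr_deriv (by ring) }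
      exact (sub_eq_zero.1 (hd.eq_zero hw (by field_simp; ring) ht)).symm
    · rw [he.1.2.2.2.1 t ht, he₀.1.2.2.2.1 t ht, mul_zero]
  exact Submodule.finiteDimensional_of_le (Submodule.span_le.2 hsub)

end Discreteness

/-! ### The Prüfer angle and its dependence on the spectral parameter. -/

section Pruefer

open Set Filter Topology

/-- The vector field of the Prüfer angle. -/
noncomputable def prueferField (σ : ℝ → ℝ) (s t θ : ℝ) : ℝ :=
  s * (σ t * Real.cos θ ^ 2 + (σ t)⁻¹ * Real.sin θ ^ 2)

/-- `φ` is the Prüfer angle on `[a, b]` with spectral parameter `s`, starting from `0`. -/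
structure IsPrueferAngle (a b : ℝ) (σ : ℝ → ℝ) (s : ℝ) (φ : ℝ → ℝ) : Prop where
  left : φ a = 0
  deriv : ∀ t ∈ Icc a b, HasDerivWithinAt φ (prueferField σ s t (φ t)) (Icc a b) t

variable {a b C s : ℝ} {σ φ : ℝ → ℝ}

theorem IsPrueferAngle.continuousOn (h : IsPrueferAngle a b σ s φ) : ContinuousOn φ (Icc a b) :=
  fun t ht => (h.deriv t ht).continuousWithinAt

theorem prueferField_eq (σ : ℝ → ℝ) (s t θ : ℝ) :
    prueferField σ s t θ = s * ((σ t)⁻¹ + (σ t - (σ t)⁻¹) * Real.cos θ ^ 2) := by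
  rw [prueferField, Real.sin_sq]
  ring

theorem le_prueferField {t : ℝ} (hs : 0 ≤ s) (h1 : C ≤ σ t) (h2 : C ≤ (σ t)⁻¹) (θ : ℝ) :
    s * C ≤ prueferField σ s t θ := by
  refine mul_le_mul_of_nonneg_left ?_ hs
  have hC : C = C * (Real.sin θ ^ 2 + Real.cos θ ^ 2) := by rw [Real.sin_sq_add_cos_sq, mul_one]
  linarith [mul_nonneg (sub_nonneg.2 h1) (sq_nonneg (Real.cos θ)),
    mul_nonneg (sub_nonneg.2 h2) (sq_nonneg (Real.sin θ))]

theorem prueferField_le {t : ℝ} (hs : 0 ≤ s) (h1 : σ t ≤ C) (h2 : (σ t)⁻¹ ≤ C) (θ : ℝ) :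
    prueferField σ s t θ ≤ s * C := by
  refine mul_le_mul_of_nonneg_left ?_ hs
  have hC : C = C * (Real.sin θ ^ 2 + Real.cos θ ^ 2) := by rw [Real.sin_sq_add_cos_sq, mul_one]
  linarith [mul_nonneg (sub_nonneg.2 h1) (sq_nonneg (Real.cos θ)),
    mul_nonneg (sub_nonneg.2 h2) (sq_nonneg (Real.sin θ))]

theorem prueferField_nonneg {t : ℝ} (hs : 0 ≤ s) (h : 0 < σ t) (θ : ℝ) :
    0 ≤ prueferField σ s t θ := by
  have := inv_pos.2 h
  unfold prueferField
  positivity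

theorem lipschitzWith_prueferField {t : ℝ} (hs : 0 ≤ s) (h0 : 0 < σ t) (h1 : σ t ≤ C)
    (h2 : (σ t)⁻¹ ≤ C) : LipschitzWith (2 * (s * C)).toNNReal (prueferField σ s t) := by
  have hC : 0 ≤ C := h0.le.trans h1
  refine LipschitzWith.of_dist_le_mul fun x y => ?_
  rw [Real.coe_toNNReal _ (by positivity), Real.dist_eq, Real.dist_eq, prueferField_eq,
    prueferField_eq]
  have hcos : |Real.cos x - Real.cos y| ≤ |x - y| := by
    simpa [Real.dist_eq] using Real.lipschitzWith_cos.dist_le_mul x y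
  have hadd : |Real.cos x + Real.cos y| ≤ 2 := by
    refine (abs_add_le _ _).trans ?_
    linarith [Real.abs_cos_le_one x, Real.abs_cos_le_one y]
  have hd : |σ t - (σ t)⁻¹| ≤ C := by
    have := inv_pos.2 h0
    exact abs_sub_le_iff.2 ⟨by linarith, by linarith⟩
  calc |s * ((σ t)⁻¹ + (σ t - (σ t)⁻¹) * Real.cos x ^ 2)
          - s * ((σ t)⁻¹ + (σ t - (σ t)⁻¹) * Real.cos y ^ 2)|
      = s * (|σ t - (σ t)⁻¹| * (|Real.cos x + Real.cos y| * |Real.cos x - Real.cos y|)) := by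
        rw [← abs_mul, ← abs_mul]
        nth_rw 3 [← abs_of_nonneg hs]
        rw [← abs_mul]
        congr 1
        ring
    _ ≤ s * (C * (2 * |x - y|)) := by gcongr
    _ = 2 * (s * C) * |x - y| := by ring

/-- The field is bounded by `s * C` and Lipschitz in the angle uniformly in time, so Picard–Lindelöf
with radius `s * C * (b - a)` reaches all of `[a, b]`. -/
theorem exists_isPrueferAngle (hab : a ≤ b) (hs : 0 ≤ s) (hσ : Continuous σ)
    (hσ0 : ∀ t, 0 < σ t) (hC : ∀ t ∈ Icc a b, σ t ≤ C ∧ (σ t)⁻¹ ≤ C) :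
    ∃ φ, IsPrueferAngle a b σ s φ := by
  have hC0 : 0 ≤ C := (hσ0 a).le.trans (hC a (left_mem_Icc.2 hab)).1
  have hL : 0 ≤ s * C := mul_nonneg hs hC0
  have hpl : IsPicardLindelof (prueferField σ s) (⟨a, left_mem_Icc.2 hab⟩ : Icc a b) 0
      (s * C * (b - a)).toNNReal 0 (s * C).toNNReal (2 * (s * C)).toNNReal :=
    { lipschitzOnWith := fun t ht =>
        (lipschitzWith_prueferField hs (hσ0 t) (hC t ht).1 (hC t ht).2).lipschitzOnWith
      continuousOn := fun x _ => by
        have hinv : Continuous fun t => (σ t)⁻¹ := hσ.inv₀ fun t => (hσ0 t).ne'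
        exact (continuous_const.mul
          ((hσ.mul continuous_const).add (hinv.mul continuous_const))).continuousOn
      norm_le := fun t ht x _ => by
        rw [Real.coe_toNNReal _ hL, Real.norm_eq_abs,
          abs_of_nonneg (prueferField_nonneg hs (hσ0 t) x)]
        exact prueferField_le hs (hC t ht).1 (hC t ht).2 x
      mul_max_le := by
        rw [Real.coe_toNNReal _ hL, Real.coe_toNNReal _ (mul_nonneg hL (sub_nonneg.2 hab))]
        simp [hab] }
  obtain ⟨φ, h1, h2⟩ := hpl.exists_eq_forall_mem_Icc_hasDerivWithinAt₀
  exact ⟨φ, h1, h2⟩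

theorem IsPrueferAngle.le_right (hab : a ≤ b) (hs : 0 ≤ s) (hσ : Continuous σ)
    (hσ0 : ∀ t, 0 < σ t) (hC : ∀ t ∈ Icc a b, C ≤ σ t ∧ C ≤ (σ t)⁻¹)
    (h : IsPrueferAngle a b σ s φ) : s * C * (b - a) ≤ φ b := by
  have hinv : Continuous fun t => (σ t)⁻¹ := hσ.inv₀ fun t => (hσ0 t).ne'
  have hc : ContinuousOn (fun t => prueferField σ s t (φ t)) (Icc a b) :=
    continuousOn_const.mul ((hσ.continuousOn.mul
      ((Real.continuous_cos.comp_continuousOn h.continuousOn).pow 2)).add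
      (hinv.continuousOn.mul ((Real.continuous_sin.comp_continuousOn h.continuousOn).pow 2)))
  have h1 := integral_eq_sub_of_hasDerivWithinAt_Icc hab h.deriv hc
  have h2 := intervalIntegral.integral_mono_on (μ := volume) hab intervalIntegrable_const
    (ContinuousOn.intervalIntegrable (by rwa [uIcc_of_le hab]))
    fun t ht => le_prueferField hs (hC t ht).1 (hC t ht).2 (φ t)
  rw [h1, h.left, intervalIntegral.integral_const, smul_eq_mul] at h2
  linarith

theorem IsPrueferAngle.right_of_zero (hab : a ≤ b) (h : IsPrueferAngle a b σ 0 φ) : φ b = 0 := by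
  have h1 := integral_eq_sub_of_hasDerivWithinAt_Icc (f' := fun _ => (0 : ℝ)) hab
    (fun x hx => by simpa [prueferField] using h.deriv x hx) continuousOn_const
  rw [h.left] at h1
  simpa using h1.symm

/-- The angle for `s'` solves the equation for `s` up to an error `|s' - s| * C`, so Grönwall
applies. It yields continuity of the endpoint in `s` and, for `s' = s`, its uniqueness. -/
theorem IsPrueferAngle.dist_right_le {s' : ℝ} {φ' : ℝ → ℝ} (hab : a ≤ b) (hs : 0 ≤ s)
    (hσ0 : ∀ t, 0 < σ t) (hC : ∀ t ∈ Icc a b, σ t ≤ C ∧ (σ t)⁻¹ ≤ C)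
    (h : IsPrueferAngle a b σ s φ) (h' : IsPrueferAngle a b σ s' φ') :
    dist (φ' b) (φ b) ≤ gronwallBound 0 (2 * (s * C)).toNNReal (|s' - s| * C) (b - a) := by
  have key := dist_le_of_approx_trajectories_ODE_of_mem (v := prueferField σ s)
    (s := fun _ => univ) (f := φ') (g := φ) (a := a) (b := b)
    (f' := fun t => prueferField σ s' t (φ' t)) (g' := fun t => prueferField σ s t (φ t))
    (K := (2 * (s * C)).toNNReal) (εf := |s' - s| * C) (εg := 0) (δ := 0)
    (fun t ht => (lipschitzWith_prueferField hs (hσ0 t) (hC t (Ico_subset_Icc_self ht)).1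
      (hC t (Ico_subset_Icc_self ht)).2).lipschitzOnWith)
    h'.continuousOn (fun t ht => (h'.deriv t (Ico_subset_Icc_self ht)).Ici_of_Icc ht)
    (fun t ht => by
      have h1 := prueferField_nonneg (σ := σ) (t := t) zero_le_one (hσ0 t) (φ' t)
      have h2 := prueferField_le (σ := σ) (t := t) zero_le_one (hC t (Ico_subset_Icc_self ht)).1
        (hC t (Ico_subset_Icc_self ht)).2 (φ' t)
      have h3 : prueferField σ s' t (φ' t) - prueferField σ s t (φ' t)
          = (s' - s) * prueferField σ 1 t (φ' t) := by
        unfold prueferField; ring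
      rw [Real.dist_eq, h3, abs_mul, abs_of_nonneg h1]
      rw [one_mul] at h2
      gcongr)
    (fun _ _ => mem_univ _)
    h.continuousOn (fun t ht => (h.deriv t (Ico_subset_Icc_self ht)).Ici_of_Icc ht)
    (fun t _ => by rw [dist_self]) (fun _ _ => mem_univ _)
    (by rw [h.left, h'.left, dist_self]) b (right_mem_Icc.2 hab)
  rwa [add_zero] at key

/-- The value at `b` of the Prüfer angle attains every nonnegative number as the spectral parameter
varies. -/
theorem exists_isPrueferAngle_right_eq (hab : a < b) (hσ : Continuous σ) (hσ0 : ∀ t, 0 < σ t)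
    {y : ℝ} (hy : 0 ≤ y) : ∃ s φ, 0 ≤ s ∧ IsPrueferAngle a b σ s φ ∧ φ b = y := by
  have hinv : Continuous fun t => (σ t)⁻¹ := hσ.inv₀ fun t => (hσ0 t).ne'
  obtain ⟨C₁, hC₁⟩ := isCompact_Icc.exists_bound_of_continuousOn (hσ.continuousOn (s := Icc a b))
  obtain ⟨C₂, hC₂⟩ := isCompact_Icc.exists_bound_of_continuousOn (hinv.continuousOn (s := Icc a b))
  set C := max C₁ C₂
  have hC : ∀ t ∈ Icc a b, σ t ≤ C ∧ (σ t)⁻¹ ≤ C := fun t ht =>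
    ⟨((le_abs_self _).trans (hC₁ t ht)).trans (le_max_left _ _),
      ((le_abs_self _).trans (hC₂ t ht)).trans (le_max_right _ _)⟩
  have hC0 : 0 < C := (hσ0 a).trans_le (hC a (left_mem_Icc.2 hab.le)).1
  have hC' : ∀ t ∈ Icc a b, C⁻¹ ≤ σ t ∧ C⁻¹ ≤ (σ t)⁻¹ := fun t ht =>
    ⟨by simpa using inv_anti₀ (inv_pos.2 (hσ0 t)) (hC t ht).2, inv_anti₀ (hσ0 t) (hC t ht).1⟩
  have hex : ∀ s : ℝ, ∃ φ, 0 ≤ s → IsPrueferAngle a b σ s φ := fun s => by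
    by_cases hs : 0 ≤ s
    · obtain ⟨φ, h⟩ := exists_isPrueferAngle hab.le hs hσ hσ0 hC
      exact ⟨φ, fun _ => h⟩
    · exact ⟨0, fun h => absurd h hs⟩
  choose φ hφ using hex
  have hcont : ContinuousOn (fun s => φ s b) (Ici 0) := by
    intro s hs
    rw [ContinuousWithinAt, tendsto_iff_dist_tendsto_zero]
    refine squeeze_zero' (.of_forall fun _ => dist_nonneg)
      (g := fun s' => gronwallBound 0 (2 * (s * C)).toNNReal (|s' - s| * C) (b - a)) ?_ ?_
    · filter_upwards [self_mem_nhdsWithin] with s' hs'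
      exact (hφ s hs).dist_right_le hab.le hs hσ0 hC (hφ s' hs')
    · have hg : Continuous fun s' : ℝ =>
          gronwallBound 0 (2 * (s * C)).toNNReal (|s' - s| * C) (b - a) :=
        (gronwallBound_continuous_ε _ _ _).comp
          (((continuous_id.sub continuous_const).abs).mul continuous_const)
      have := hg.tendsto s
      simp only [sub_self, abs_zero, zero_mul, gronwallBound_ε0_δ0] at this
      exact this.mono_left nhdsWithin_le_nhds
  have hba : 0 < b - a := sub_pos.2 hab
  -- Chosen so that the lower bound `S * C⁻¹ * (b - a)` for the endpoint equals `y`.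
  set S : ℝ := y * C / (b - a)
  have hS : 0 ≤ S := by positivity
  have hmem : y ∈ Icc (φ 0 b) (φ S b) := by
    refine ⟨((hφ 0 le_rfl).right_of_zero hab.le).trans_le hy, ?_⟩
    refine le_trans (le_of_eq ?_) ((hφ S hS).le_right hab.le hS hσ hσ0 hC')
    simp only [S]
    field_simp
  obtain ⟨s, hs, hsy⟩ :=
    intermediate_value_Icc hS (hcont.mono fun x hx => hx.1) hmem
  exact ⟨s, φ s, hs.1, hφ s hs.1, hsy⟩

end Pruefer

/-! ### Infinitely many eigenvalues from the Prüfer angle. -/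

section Infinite

open Set Filter Topology

variable (𝕜 : Type*) [RCLike 𝕜] {a b s : ℝ} {w φ : ℝ → ℝ}

theorem IsPrueferAngle.neg_sq_mem_weakEigenvalues (hab : a < b) (hw : Continuous w)
    (h : IsPrueferAngle a b (integratingFactor a w) s φ) {n : ℕ} (hn : n ≠ 0)
    (hb : φ b = n * Real.pi) : ((-s ^ 2 : ℝ) : 𝕜) ∈ weakEigenvalues 𝕜 a b w := by
  set σ := integratingFactor a w with hσdef
  have hσc : Continuous σ := continuous_integratingFactor hw
  have hσ0 : ∀ t, 0 < σ t := integratingFactor_pos a w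
  have hinv : Continuous fun t => (σ t)⁻¹ := hσc.inv₀ fun t => (hσ0 t).ne'
  have hφc := h.continuousOn
  -- `k` is the logarithmic derivative `r' / r` of the Prüfer amplitude that the system forces on `σ
  -- e = r sin φ`, `q = s r cos φ`.
  set k : ℝ → ℝ := fun t => s * (Real.sin (φ t) * Real.cos (φ t) * (σ t - (σ t)⁻¹)) with hk
  have hkc : ContinuousOn k (Icc a b) :=
    continuousOn_const.mul (((Real.continuous_sin.comp_continuousOn hφc).mul
      (Real.continuous_cos.comp_continuousOn hφc)).mul (hσc.sub hinv).continuousOn)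
  set r : ℝ → ℝ := fun t => Real.exp (∫ x in a..t, k x) with hr
  have hrd : ∀ t ∈ Icc a b, HasDerivWithinAt r (r t * k t) (Icc a b) t := fun t ht =>
    (hkc.hasDerivWithinAt_primitive ht).exp
  have hσd : ∀ t, HasDerivAt (fun t => (σ t)⁻¹) (w t * (σ t)⁻¹) t := fun t => by
    refine ((hasDerivAt_integratingFactor (a := a) hw t).inv (hσ0 t).ne').congr_deriv ?_
    have := (hσ0 t).ne'
    rw [← hσdef]
    field_simp
  set e : ℝ → ℝ := fun t => (σ t)⁻¹ * (r t * Real.sin (φ t)) with he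
  set q : ℝ → ℝ := fun t => s * (r t * Real.cos (φ t)) with hq
  have hed : ∀ t ∈ Icc a b, HasDerivWithinAt e (w t * e t + q t) (Icc a b) t := fun t ht => by
    refine ((hσd t).hasDerivWithinAt.mul ((hrd t ht).mul (h.deriv t ht).sin)).congr_deriv ?_
    simp only [he, hq, hk, prueferField, Pi.mul_apply]
    have := (hσ0 t).ne'
    field_simp
    linear_combination
      (s * r t * σ t ^ 2 * Real.cos (φ t)) * Real.sin_sq_add_cos_sq (φ t)
  have hqd : ∀ t ∈ Icc a b, HasDerivWithinAt q (-s ^ 2 * e t) (Icc a b) t := fun t ht => by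
    refine (((hrd t ht).mul (h.deriv t ht).cos).const_mul s).congr_deriv ?_
    simp only [he, hk, prueferField]
    have := (hσ0 t).ne'
    field_simp
    linear_combination
      (-(s ^ 2) * r t * Real.sin (φ t)) * Real.sin_sq_add_cos_sq (φ t)
  have hea : e a = 0 := by simp [he, h.left]
  have heb : e b = 0 := by simp [he, hb, Real.sin_nat_mul_pi]
  set f : ℝ → 𝕜 := (Icc a b).indicator fun t => (e t : 𝕜) with hf
  have hfe : EqOn f (fun t => (e t : 𝕜)) (Icc a b) := fun t ht => indicator_of_mem ht _
  have hsol : IsDirichletSolution a b w ((-s ^ 2 : ℝ) : 𝕜) f (fun t => (q t : 𝕜)) :=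
    { left := by rw [hfe (left_mem_Icc.2 hab.le)]; simp [hea]
      right := by rw [hfe (right_mem_Icc.2 hab.le)]; simp [heb]
      deriv_fst := fun t ht => by
        refine ((hed t ht).ofReal_comp_rclike.congr hfe (hfe ht)).congr_deriv ?_
        rw [hfe ht]; push_cast; ring
      deriv_snd := fun t ht => by
        refine (hqd t ht).ofReal_comp_rclike.congr_deriv ?_
        rw [hfe ht]; push_cast; ring }
  refine ⟨f, hsol.mem_weakEigenfunctions hab.le hw (fun t ht => indicator_of_notMem ht _) ?_⟩
  have hpi := Real.pi_pos
  have hn1 : (1 : ℝ) ≤ n := by exact_mod_cast Nat.one_le_iff_ne_zero.2 hn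
  -- Since `n ≥ 1`, the angle passes through `π / 2`, where `e = σ⁻¹ r` is nonzero; for `n = 0` this
  -- would break down.
  obtain ⟨t, ht, htφ⟩ := intermediate_value_Icc hab.le hφc
    (show Real.pi / 2 ∈ Icc (φ a) (φ b) by
      rw [h.left, hb]
      exact ⟨by positivity, by nlinarith⟩)
  refine Function.ne_iff.2 ⟨t, ?_⟩
  rw [hfe ht, Pi.zero_apply]
  refine RCLike.ofReal_ne_zero.2 ?_
  simp only [he, htφ, Real.sin_pi_div_two, mul_one]
  exact mul_ne_zero (inv_ne_zero (hσ0 t).ne') (Real.exp_ne_zero _)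

theorem infinite_weakEigenvalues (hab : a < b) (hw : Continuous w) :
    (weakEigenvalues 𝕜 a b w).Infinite := by
  have hex := fun n : ℕ => exists_isPrueferAngle_right_eq hab
    (continuous_integratingFactor (a := a) hw) (integratingFactor_pos a w)
    (y := ((n + 1 : ℕ) : ℝ) * Real.pi) (by positivity)
  choose s φ hs hφ hb using hex
  refine Set.infinite_of_injective_forall_mem (f := fun n : ℕ => ((-s n ^ 2 : ℝ) : 𝕜)) ?_
    fun n => (hφ n).neg_sq_mem_weakEigenvalues 𝕜 hab hw n.succ_ne_zero (hb n)
  -- Equal eigenvalues force equal `s ≥ 0`, hence equal endpoints `(m + 1) π = (n + 1) π` by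
  -- uniqueness of the angle.
  intro m n hmn
  have hsq : s m ^ 2 = s n ^ 2 := by
    have h1 : (-s m ^ 2 : ℝ) = -s n ^ 2 := RCLike.ofReal_injective hmn
    linarith
  have hmn' : s m = s n := (pow_left_inj₀ (hs m) (hs n) two_ne_zero).1 hsq
  obtain ⟨C, hC⟩ : ∃ C, ∀ t ∈ Icc a b,
      integratingFactor a w t ≤ C ∧ (integratingFactor a w t)⁻¹ ≤ C := by
    have hσ := continuous_integratingFactor (a := a) hw
    have hinv := hσ.inv₀ fun t => (integratingFactor_pos a w t).ne'
    obtain ⟨C, hC⟩ := isCompact_Icc.exists_bound_of_continuousOn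
      ((hσ.max hinv).continuousOn (s := Icc a b))
    exact ⟨C, fun t ht => max_le_iff.1 ((le_abs_self _).trans (hC t ht))⟩
  have hdist := (hφ n).dist_right_le hab.le (hs n) (integratingFactor_pos a w) hC (hφ m)
  rw [hmn', sub_self, abs_zero, zero_mul, gronwallBound_ε0_δ0] at hdist
  have heq : φ m b = φ n b := dist_le_zero.1 hdist
  rw [hb, hb] at heq
  have := mul_right_cancel₀ Real.pi_pos.ne' heq
  exact Nat.succ_injective (by exact_mod_cast this)

end Infinite

theorem mainTheorem5 {Ω : Type*} [MeasurableSpace Ω] (P : Measure Ω) [IsProbabilityMeasure P]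
    (𝕜 : Type*) [RCLike 𝕜] (a b : ℝ) (hab : a < b)
    (W : ℝ → Ω → ℝ) (hW : IsBrownianMotionOn a b W P) :
    ∀ᵐ ω ∂P,
      (weakEigenvalues 𝕜 a b (fun t => W t ω)).Countable ∧
      (weakEigenvalues 𝕜 a b (fun t => W t ω)).Infinite ∧
      (∀ R : ℝ, {μ : 𝕜 | μ ∈ weakEigenvalues 𝕜 a b (fun t => W t ω) ∧ ‖μ‖ ≤ R}.Finite) ∧
      (∀ μ : 𝕜, FiniteDimensional 𝕜
        (Submodule.span 𝕜 (weakEigenfunctions 𝕜 a b (fun t => W t ω) μ))) := by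
  filter_upwards [hW.continuous_paths] with ω hω
  -- The path is continuous only on `[a, b]`, and the form sees nothing else, so it is replaced by a
  -- continuous extension to `ℝ`.
  set w : ℝ → ℝ := Set.IccExtend hab.le ((Set.Icc a b).domRestrict fun t => W t ω) with hwdef
  have hw : Continuous w := hω.domRestrict.Icc_extend'
  have heq : Set.EqOn (fun t => W t ω) w (Set.Icc a b) := fun t ht =>
    (Set.IccExtend_of_mem hab.le ((Set.Icc a b).domRestrict fun t => W t ω) ht).symm
  rw [weakEigenvalues_congr hab.le heq]
  refine ⟨countable_weakEigenvalues hab hw, infinite_weakEigenvalues 𝕜 hab hw,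
    finite_weakEigenvalues_norm_le hab hw, fun μ => ?_⟩
  rw [weakEigenfunctions_congr hab.le heq]
  exact finiteDimensional_span_weakEigenfunctions hab hw μ
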